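/- For a finite simple graph $G$ with $n\ge 2$ vertices and $m$ edges, let $d=2m/n$ be its average degree, let $p=m/\binom n2$ be its edge density, and let $$\mathrm{disc}^+(G)=\max_{U\subseteq V(G)}\Bigl(e(G[U])-p\binom{|U|}{2}\Bigr)$$ be its positive discrepancy, where $e(G[U])$ is the number of edges of the subgraph of $G$ induced on $U$. There exists $c>0$, and for every $\varepsilon\in(0,1/2)$ there exists $c_1=c_1(\varepsilon)>0$, such that the following holds for every sufficiently large $n$ (how large may depend on $\varepsilon$). Let $G$ be a graph on $n$ vertices of average degree $d\ge 1$. Then $$\mathrm{disc}^{+}(G)> \begin{cases} c\,d^{1/2}n &\mbox{if } d\leq n^{2/3},\\ c\, n^2/d & \mbox{if } n^{2/3}\leq d\leq n^{4/5},\\ c_1d^{1/4}n/\log n & \mbox{if } n^{4/5}\leq d\leq (1/2-\varepsilon)n.\end{cases}$$ Here $\log$ is the natural logarithm. -/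

import Mathlib

universe u

namespace GraphDisc

variable {V : Type u} [Fintype V]

/-- The number `e(G[U])` of edges of the subgraph of `G` induced on `U`. -/
noncomputable def edgesIn (G : SimpleGraph V) (U : Finset V) : ℕ :=
  (G.induce (U : Set V)).edgeSet.ncard

/-- The edge density `p = e(G) / (n choose 2)` of a graph with `n` vertices. -/
noncomputable def density (G : SimpleGraph V) : ℝ :=
  (G.edgeSet.ncard : ℝ) / ((Fintype.card V).choose 2 : ℝ)

/-- The average degree `d = 2 e(G) / n` of a graph with `n` vertices. -/
noncomputable def avgDegree (G : SimpleGraph V) : ℝ :=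
  2 * (G.edgeSet.ncard : ℝ) / (Fintype.card V : ℝ)

/-- The discrepancy `e(G[U]) - p * (|U| choose 2)` of a vertex set `U`. -/
noncomputable def disc (G : SimpleGraph V) (U : Finset V) : ℝ :=
  (edgesIn G U : ℝ) - density G * (U.card.choose 2 : ℝ)

/-- The positive discrepancy: the maximum of `disc G U` over all vertex sets `U`. -/
noncomputable def posDisc (G : SimpleGraph V) : ℝ :=
  (Finset.univ : Finset (Finset V)).sup' Finset.univ_nonempty (disc G)

end GraphDisc

/-! Put `E = A - p(J - I)` and `M = posDisc G`. The entries of `E` sum to zero and its diagonal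
vanishes, so `quad E ≤ 8M` on `[-1,1]^V`; lower bounds for `M` come from good test vectors or their
semidefinite relaxation.

For `d ≤ n^(4/5)`, attach to each vertex of degree at most `4d` the random number `sin(ξ_v/2 + β ∑
ξ_w)`, with `w` over its neighbours of such degree. The sine keeps it in `[-1,1]`, and correlations
still behave like inner products: of order at least `β` on edges, at most `β A_uv + β² codeg(u,v)`
in general. Edges gain about `β d n`, codegrees cost about `β² d³`. Taking `β` of order
`min(d^(-1/2), n/d²)` gives `d^(1/2) n` and `n²/d`. The key lemmas are `le_expect_sin_mul_sin`,
`expect_sin_mul_sin_le` and `le_posDisc_of_degree_le`.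

For larger `d`, the relaxation has value at most `s = O(M log n)` (`matInner_le_log`), so duality
(`exists_dual`) yields a diagonal `D` of trace at most `s` with `P = D - E` positive semidefinite.
By Schur, `P ∘ P` is again a test matrix once restricted to the vertices where `D = O(s/n)`. Pairing
it with `E` gives `∑ E_uv³ = O(s³/n²)`. The cube of a two-valued entry is affine in it, with
constant term `(1-2p)p(1-p)`, so the left side is of order `εdn` unless `M` is already large. This
even yields `d^(1/3) n / log n`, for fixed `ε`. -/

namespace GraphDisc

open Finset Matrix
open scoped BigOperators

/-! ### Averages over uniformly random signs -/

section Signs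

variable {ι : Type*} [Fintype ι]

/-- The sign `±1` encoded by a Boolean. -/
def rsign (b : Bool) : ℝ := if b then 1 else -1

/-- The linear form `∑ aᵢ ξᵢ` in the signs `ξ`. -/
def signSum (a : ι → ℝ) (ξ : ι → Bool) : ℝ := ∑ i, a i * rsign (ξ i)

lemma signSum_neg (a : ι → ℝ) (ξ : ι → Bool) : signSum (-a) ξ = - signSum a ξ := by
  simp [signSum]

lemma signSum_add (a b : ι → ℝ) (ξ : ι → Bool) :
    signSum (a + b) ξ = signSum a ξ + signSum b ξ := by
  simp [signSum, add_mul, sum_add_distrib]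

lemma signSum_sub (a b : ι → ℝ) (ξ : ι → Bool) :
    signSum (a - b) ξ = signSum a ξ - signSum b ξ := by
  simp [signSum, sub_mul, sum_sub_distrib]

lemma signSum_smul (c : ℝ) (a : ι → ℝ) (ξ : ι → Bool) :
    signSum (c • a) ξ = c * signSum a ξ := by
  simp [signSum, mul_sum, mul_assoc]

variable [DecidableEq ι]

lemma expect_prod {K : Type*} [Field K] [CharZero K] (g : ι → Bool → K) :
    𝔼 ξ : ι → Bool, ∏ i, g i (ξ i) = ∏ i, 𝔼 b, g i b := by
  simp only [Fintype.expect_eq_sum_div_card, Finset.prod_div_distrib, Fintype.prod_sum]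
  simp

lemma expect_bool {K : Type*} [Field K] [CharZero K] (g : Bool → K) :
    𝔼 b, g b = (g true + g false) / 2 := by
  rw [Fintype.expect_eq_sum_div_card]
  simp

lemma expect_exp_signSum (a : ι → ℝ) :
    𝔼 ξ, Real.exp (signSum a ξ) = ∏ i, Real.cosh (a i) := by
  simp only [signSum, Real.exp_sum]
  rw [expect_prod (fun i b => Real.exp (a i * rsign b))]
  refine prod_congr rfl fun i _ => ?_
  rw [expect_bool, Real.cosh_eq]
  simp [rsign]

lemma expect_cosh_signSum (a : ι → ℝ) :
    𝔼 ξ, Real.cosh (signSum a ξ) = ∏ i, Real.cosh (a i) := by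
  have h2 := expect_exp_signSum (-a)
  simp only [signSum_neg, Pi.neg_apply, Real.cosh_neg] at h2
  simp only [Real.cosh_eq, ← expect_div, expect_add_distrib]
  rw [expect_exp_signSum a, h2]
  simp only [← Real.cosh_eq]
  ring

lemma expect_cosh_signSum_le (a : ι → ℝ) :
    𝔼 ξ, Real.cosh (signSum a ξ) ≤ Real.exp ((∑ i, a i ^ 2) / 2) := by
  rw [expect_cosh_signSum, sum_div, Real.exp_sum]
  exact prod_le_prod (fun i _ => (Real.cosh_pos _).le) fun i _ => Real.cosh_le_exp_half_sq _

lemma expect_cos_signSum (a : ι → ℝ) :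
    𝔼 ξ, Real.cos (signSum a ξ) = ∏ i, Real.cos (a i) := by
  have h : 𝔼 ξ, Complex.exp (signSum a ξ * Complex.I) = ∏ i, Complex.cos (a i) := by
    simp only [signSum, Complex.ofReal_sum, sum_mul, Complex.exp_sum]
    rw [expect_prod (fun i b => Complex.exp ((a i * rsign b : ℝ) * Complex.I))]
    refine prod_congr rfl fun i _ => ?_
    rw [expect_bool, Complex.cos]
    simp [rsign]
  have h' := congrArg Complex.re h
  simp only [← Complex.ofReal_cos, ← Complex.ofReal_prod, Complex.ofReal_re] at h'
  rw [← h', Fintype.expect_eq_sum_div_card, Fintype.expect_eq_sum_div_card]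
  rw [← Complex.ofReal_natCast, Complex.div_ofReal_re, Complex.re_sum]
  simp [Complex.exp_ofReal_mul_I_re]

/-- Product-to-sum reduces the covariance to expected cosines, which factor by independence. -/
lemma expect_sin_mul_sin (a b : ι → ℝ) :
    𝔼 ξ, Real.sin (signSum a ξ) * Real.sin (signSum b ξ) =
      (∏ i, Real.cos (a i - b i) - ∏ i, Real.cos (a i + b i)) / 2 := by
  have h1 := expect_cos_signSum (a - b)
  have h2 := expect_cos_signSum (a + b)
  simp only [Pi.sub_apply, Pi.add_apply] at h1 h2
  rw [← h1, ← h2, ← expect_sub_distrib, expect_div]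
  refine expect_congr rfl fun ξ _ => ?_
  rw [signSum_sub, signSum_add, Real.cos_sub, Real.cos_add]
  ring

lemma expect_rsign_mul_rsign (i j : ι) :
    𝔼 ξ : ι → Bool, rsign (ξ i) * rsign (ξ j) = if i = j then 1 else 0 := by
  have h : ∀ ξ : ι → Bool, rsign (ξ i) * rsign (ξ j) =
      ∏ k, (if k = i then rsign (ξ k) else 1) * (if k = j then rsign (ξ k) else 1) := by
    intro ξ
    rw [prod_mul_distrib]
    simp
  simp only [h]
  rw [expect_prod (fun k b => (if k = i then rsign b else 1) * (if k = j then rsign b else 1))]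
  split_ifs with hij
  · subst hij
    refine prod_eq_one fun k _ => ?_
    rw [expect_bool]
    split_ifs <;> norm_num [rsign]
  · refine prod_eq_zero (mem_univ i) ?_
    rw [expect_bool]
    simp [hij, rsign]

lemma expect_signSum_mul_signSum (a b : ι → ℝ) :
    𝔼 ξ, signSum a ξ * signSum b ξ = ∑ i, a i * b i := by
  have h : ∀ ξ, signSum a ξ * signSum b ξ =
      ∑ i, ∑ j, a i * b j * (rsign (ξ i) * rsign (ξ j)) := by
    intro ξ
    simp only [signSum, sum_mul_sum]
    refine sum_congr rfl fun i _ => sum_congr rfl fun j _ => by ring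
  simp only [h, expect_sum_comm, ← mul_expect, expect_rsign_mul_rsign]
  simp

end Signs

/-! ### Rounding positive semidefinite matrices -/

section Rounding

variable {V : Type*} [Fintype V]

/-- The quadratic form `xᵀ A x` of the matrix `A`. -/
def quad (A : Matrix V V ℝ) (x : V → ℝ) : ℝ := ∑ u, ∑ v, A u v * (x u * x v)

/-- The entrywise inner product of two matrices. -/
def matInner (A X : Matrix V V ℝ) : ℝ := ∑ u, ∑ v, A u v * X u v

lemma quad_smul (A : Matrix V V ℝ) (c : ℝ) (x : V → ℝ) : quad A (c • x) = c ^ 2 * quad A x := by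
  simp only [quad, mul_sum, Pi.smul_apply, smul_eq_mul]
  refine sum_congr rfl fun i _ => sum_congr rfl fun j _ => by ring

lemma quad_le_of_sq_le {A : Matrix V V ℝ} {M : ℝ} (hA : ∀ x, (∀ v, |x v| ≤ 1) → quad A x ≤ M)
    {x : V → ℝ} {r : ℝ} (hr : 0 ≤ r) (hx : ∀ v, x v ^ 2 ≤ r) : quad A x ≤ M * r := by
  rcases hr.eq_or_lt with rfl | hr
  · have : x = 0 := funext fun v => by
      have := hx v
      exact pow_eq_zero_iff two_ne_zero |>.1 (le_antisymm this (sq_nonneg _))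
    simp [this, quad]
  have hs : 0 < √r := Real.sqrt_pos.2 hr
  have h := hA ((√r)⁻¹ • x) fun v => by
    rw [Pi.smul_apply, smul_eq_mul, abs_mul, abs_of_pos (inv_pos.2 hs), inv_mul_le_iff₀ hs, mul_one]
    exact Real.abs_le_sqrt (hx v)
  rw [quad_smul, inv_pow, Real.sq_sqrt hr.le, inv_mul_le_iff₀ hr] at h
  linarith

/-- A smooth substitute for truncation at `T`: the exponential tail can be summed over all vertices,
replacing a maximum by an expectation. -/
lemma sq_le_mul_cosh {T : ℝ} (hT : 0 < T) (hT2 : 2 ≤ T ^ 2) (y : ℝ) :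
    y ^ 2 ≤ T ^ 2 * (1 + 2 * Real.exp (-T ^ 2) * Real.cosh (T * y)) := by
  wlog hy : 0 ≤ y generalizing y
  · have := this (-y) (by linarith)
    simpa using this
  rcases le_or_gt y T with h | h
  · have : 0 ≤ Real.exp (-T ^ 2) * Real.cosh (T * y) := by positivity
    have h2 : y ^ 2 ≤ T ^ 2 := by gcongr
    nlinarith [sq_nonneg T]
  · have h1 : Real.exp (T * y) ≤ 2 * Real.cosh (T * y) := by
      rw [Real.cosh_eq]; linarith [Real.exp_pos (-(T * y))]
    have h2 : Real.exp (T * (y - T)) ≤ 2 * Real.exp (-T ^ 2) * Real.cosh (T * y) := by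
      have : Real.exp (T * (y - T)) = Real.exp (-T ^ 2) * Real.exp (T * y) := by
        rw [← Real.exp_add]; ring_nf
      rw [this]
      nlinarith [Real.exp_pos (-T ^ 2)]
    have h3 : y / T ≤ Real.exp (y / T - 1) := by
      linarith [Real.add_one_le_exp (y / T - 1)]
    have h4 : (y / T) ^ 2 ≤ Real.exp (T * (y - T)) := by
      calc (y / T) ^ 2 ≤ (Real.exp (y / T - 1)) ^ 2 := by gcongr
        _ = Real.exp (2 * (y / T - 1)) := by rw [← Real.exp_nat_mul]; norm_num
        _ ≤ Real.exp (T * (y - T)) := by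
          apply Real.exp_le_exp.2
          have : y / T - 1 = (y - T) / T := by field_simp
          rw [this, ← mul_div_assoc, div_le_iff₀ hT]
          nlinarith
    have h5 : y ^ 2 = T ^ 2 * (y / T) ^ 2 := by field_simp
    rw [h5]
    have : (0 : ℝ) ≤ T ^ 2 := sq_nonneg T
    nlinarith

lemma exists_gram [DecidableEq V] {X : Matrix V V ℝ} (hX : X.PosSemidef) :
    ∃ B : Matrix V V ℝ, ∀ u v, X u v = ∑ k, B k u * B k v := by
  open scoped MatrixOrder in
  obtain ⟨B, rfl⟩ := CStarAlgebra.nonneg_iff_eq_star_mul_self.mp hX.nonneg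
  exact ⟨B, fun u v => by simp [star_eq_conjTranspose, Matrix.mul_apply]⟩

/-- If the quadratic form of `A` is at most `M` on the cube, then its semidefinite relaxation is
at most `O(M log n)`. -/
theorem matInner_le_log [DecidableEq V] {A : Matrix V V ℝ} {M : ℝ}
    (hA : ∀ x, (∀ v, |x v| ≤ 1) → quad A x ≤ M) (hV : 3 ≤ Fintype.card V)
    {X : Matrix V V ℝ} (hX : X.PosSemidef) {R : ℝ} (hR : ∀ v, X v v ≤ R) :
    matInner A X ≤ 6 * Real.log (Fintype.card V) * M * R := by
  have hM : 0 ≤ M := by simpa [quad] using hA 0 (by simp)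
  have hne : Nonempty V := Fintype.card_pos_iff.1 (by omega)
  have hR0 : 0 ≤ R := (hX.diag_nonneg (i := Classical.arbitrary V)).trans (hR _)
  obtain ⟨B, hB⟩ := exists_gram hX
  rcases hR0.eq_or_lt with rfl | hR0
  · have h0 : ∀ k v, B k v = 0 := fun k v => by
      have h := (hR v)
      rw [hB] at h
      have h2 := (sum_eq_zero_iff_of_nonneg (fun k _ => mul_self_nonneg (B k v))).1
        (le_antisymm h (sum_nonneg fun k _ => mul_self_nonneg _)) k (mem_univ _)
      exact mul_self_eq_zero.1 h2
    simp [matInner, hB, h0]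
  set n : ℝ := (Fintype.card V : ℝ) with hn
  have hn3 : (3 : ℝ) ≤ n := by rw [hn]; exact_mod_cast hV
  have hlog : 1 ≤ Real.log n := by
    rw [Real.le_log_iff_exp_le (by linarith)]
    linarith [Real.exp_one_lt_d9]
  -- Each expected `cosh` is at most `exp (T²/2) = n`, so their sum is at most `n²`, which `exp
  -- (-T²) = n⁻²` cancels.
  set T := √(2 * Real.log n) with hTdef
  have hT2 : T ^ 2 = 2 * Real.log n := Real.sq_sqrt (by linarith)
  have hT : 0 < T := Real.sqrt_pos.2 (by linarith)
  set s := √R with hs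
  have hs0 : 0 < s := Real.sqrt_pos.2 hR0
  have hsR : s ^ 2 = R := Real.sq_sqrt hR0.le
  let b : V → V → ℝ := fun v k => s⁻¹ * B k v
  have hb : ∀ v, ∑ k, (b v k) ^ 2 ≤ 1 := fun v => by
    have h := hR v
    rw [hB] at h
    have : ∑ k, (b v k) ^ 2 = R⁻¹ * ∑ k, B k v * B k v := by
      rw [mul_sum]
      refine sum_congr rfl fun k _ => ?_
      simp only [b, ← hsR]
      field_simp
    rw [this, inv_mul_le_iff₀ hR0]
    linarith
  have hpt : ∀ ξ : V → Bool, quad A (fun v => signSum (b v) ξ) ≤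
      M * (T ^ 2 * (1 + 2 * Real.exp (-T ^ 2) * ∑ v, Real.cosh (T * signSum (b v) ξ))) := by
    intro ξ
    refine quad_le_of_sq_le hA ?_ fun v => ?_
    · have : 0 ≤ ∑ v, Real.cosh (T * signSum (b v) ξ) :=
        sum_nonneg fun v _ => (Real.cosh_pos _).le
      positivity
    · refine (sq_le_mul_cosh hT (by linarith) _).trans ?_
      gcongr
      exact single_le_sum (f := fun v => Real.cosh (T * signSum (b v) ξ))
        (fun v _ => (Real.cosh_pos _).le) (mem_univ v)
  have hexp := expect_le_expect (s := univ) (fun ξ _ => hpt ξ)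
  have hlhs : 𝔼 ξ, quad A (fun v => signSum (b v) ξ) = R⁻¹ * matInner A X := by
    simp only [quad, expect_sum_comm, ← mul_expect, expect_signSum_mul_signSum, matInner, mul_sum]
    refine sum_congr rfl fun u _ => sum_congr rfl fun v _ => ?_
    rw [hB, mul_sum, mul_sum]
    refine sum_congr rfl fun k _ => ?_
    simp only [b, ← hsR]
    field_simp
  have hcosh : ∀ v, 𝔼 ξ, Real.cosh (T * signSum (b v) ξ) ≤ n := fun v => by
    simp only [← signSum_smul]
    refine (expect_cosh_signSum_le _).trans ?_
    rw [← Real.le_log_iff_exp_le (by linarith)]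
    have : ∑ i, (T • b v) i ^ 2 = T ^ 2 * ∑ i, (b v i) ^ 2 := by
      simp [mul_sum, mul_pow]
    rw [this, hT2]
    nlinarith [hb v]
  have hE : Real.exp (-T ^ 2) = (n ^ 2)⁻¹ := by
    rw [hT2, Real.exp_neg, two_mul, Real.exp_add, Real.exp_log (by linarith), sq]
  rw [hlhs] at hexp
  simp only [← mul_expect, expect_add_distrib, expect_sum_comm, Fintype.expect_const] at hexp
  have hsum : ∑ v, 𝔼 ξ, Real.cosh (T * signSum (b v) ξ) ≤ n ^ 2 := by
    refine (sum_le_sum fun v _ => hcosh v).trans ?_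
    simp [sq, hn]
  have hfin : 2 * Real.exp (-T ^ 2) * ∑ v, 𝔼 ξ, Real.cosh (T * signSum (b v) ξ) ≤ 2 := by
    rw [hE, mul_assoc, inv_mul_eq_div]
    have : (0 : ℝ) < n ^ 2 := by positivity
    have := (div_le_one this).2 hsum
    linarith
  rw [inv_mul_le_iff₀ hR0] at hexp
  refine hexp.trans ?_
  calc _ ≤ R * (M * (T ^ 2 * (1 + 2))) := by gcongr
    _ = _ := by rw [hT2]; ring

end Rounding

/-! ### Semidefinite duality -/

section Duality

variable {V : Type*} [Fintype V]

lemma posSemidef_gram (B : V → V → ℝ) :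
    (Matrix.of fun u v => ∑ k, B k u * B k v : Matrix V V ℝ).PosSemidef := by
  have h := posSemidef_conjTranspose_mul_self (Matrix.of B)
  have h2 : (Matrix.of B)ᴴ * Matrix.of B = Matrix.of fun u v => ∑ k, B k u * B k v := by
    ext u v
    simp [Matrix.mul_apply]
  rwa [h2] at h

variable [DecidableEq V]

/-- The semidefinite relaxation attains its maximum. -/
lemma exists_max_matInner (A : Matrix V V ℝ) :
    ∃ X : Matrix V V ℝ, X.PosSemidef ∧ (∀ v, X v v ≤ 1) ∧
      ∀ Y : Matrix V V ℝ, Y.PosSemidef → (∀ v, Y v v ≤ 1) → matInner A Y ≤ matInner A X := by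
  -- Compactness is read off the Gram factors, whose columns lie in the unit ball.
  let S : Set (V → V → ℝ) := {B | ∀ v, ∑ k, B k v * B k v ≤ 1}
  let f : (V → V → ℝ) → ℝ := fun B => matInner A (Matrix.of fun u v => ∑ k, B k u * B k v)
  have hf : Continuous f := by
    simp only [f, matInner, Matrix.of_apply]
    fun_prop
  have hcl : IsClosed S := by
    simp only [S, Set.ofPred_forall]
    exact isClosed_iInter fun v => isClosed_le (by fun_prop) continuous_const
  have hsub : S ⊆ Set.Icc (fun _ _ => -1) (fun _ _ => 1) := by
    intro B hB
    have h : ∀ k v, |B k v| ≤ 1 := fun k v => by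
      have h1 := single_le_sum (f := fun k => B k v * B k v) (fun k _ => mul_self_nonneg _)
        (mem_univ k)
      have h2 := h1.trans (hB v)
      rw [← sq_le_one_iff_abs_le_one, sq]
      exact h2
    exact ⟨fun k v => (abs_le.1 (h k v)).1, fun k v => (abs_le.1 (h k v)).2⟩
  have hcomp : IsCompact S := isCompact_Icc.of_isClosed_subset hcl hsub
  obtain ⟨B, hBS, hB⟩ := hcomp.exists_isMaxOn ⟨0, fun v => by simp⟩ hf.continuousOn
  refine ⟨_, posSemidef_gram B, fun v => hBS v, fun Y hY hY1 => ?_⟩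
  obtain ⟨C, hC⟩ := exists_gram hY
  have hYC : Y = Matrix.of fun u v => ∑ k, C k u * C k v := by
    ext u v
    exact hC u v
  rw [hYC]
  exact hB (show C ∈ S from fun v => by rw [← hC]; exact hY1 v)

/-- Used twice: to perturb an optimum towards `z zᵀ` and renormalise, and, with `t = 0` and `r` an
indicator, to restrict to a principal submatrix. -/
lemma posSemidef_rescale {X : Matrix V V ℝ} (hX : X.PosSemidef) (r z : V → ℝ) {t : ℝ}
    (ht : 0 ≤ t) :
    (Matrix.of fun u v => r u * (X u v + t * (z u * z v)) * r v : Matrix V V ℝ).PosSemidef := by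
  have h1 : (X + t • vecMulVec z (star z)).PosSemidef :=
    hX.add ((posSemidef_vecMulVec_self_star z).smul ht)
  have h2 := h1.mul_mul_conjTranspose_same (Matrix.diagonal r)
  convert h2 using 1
  ext u v
  simp [vecMulVec_apply]

lemma hasDerivAt_inv_sqrt (c : ℝ) :
    HasDerivAt (fun t : ℝ => (√(1 + t * c))⁻¹) (-c / 2) 0 := by
  have h1 : HasDerivAt (fun t : ℝ => 1 + t * c) c 0 := by
    simpa using ((hasDerivAt_id (0 : ℝ)).mul_const c).const_add 1
  have h2 := (h1.sqrt (by simp)).fun_inv (by simp)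
  refine h2.congr_deriv ?_
  simp
  ring

/-- The optimality condition of the semidefinite relaxation: a dual feasible diagonal matrix of
the same value. -/
theorem exists_dual {A : Matrix V V ℝ} (hA : A.IsSymm) (hdiag : ∀ v, A v v = 0) :
    ∃ (X : Matrix V V ℝ) (D : V → ℝ), X.PosSemidef ∧ (∀ v, X v v ≤ 1) ∧ (∀ v, 0 ≤ D v) ∧
      (Matrix.diagonal D - A).PosSemidef ∧ ∑ v, D v = matInner A X := by
  obtain ⟨X, hX, hX1, hmax⟩ := exists_max_matInner A
  have hAs : ∀ u v, A u v = A v u := fun u v => (hA.apply u v).symm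
  have hXs : ∀ u v, X u v = X v u := fun u v => by
    simpa using (hX.isHermitian.apply u v).symm
  -- Complementary slackness forces this choice: `(D - A) X` must have zero diagonal.
  set D : V → ℝ := fun u => ∑ v, A u v * X u v with hD
  -- The path below stays feasible for `t ≥ 0`, so its derivative at `0`, which is `quad A z - ∑
  -- z_v² D_v`, cannot be positive.
  have key : ∀ z : V → ℝ, quad A z ≤ ∑ v, z v ^ 2 * D v := by
    intro z
    let r : ℝ → V → ℝ := fun t v => (√(1 + t * z v ^ 2))⁻¹
    let g : ℝ → ℝ := fun t => ∑ u, ∑ v, A u v * (r t u * (X u v + t * (z u * z v)) * r t v)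
    have hg0 : g 0 = matInner A X := by simp [g, r, matInner]
    have hgle : ∀ t : ℝ, 0 ≤ t → g t ≤ g 0 := fun t ht => by
      rw [hg0]
      refine hmax _ (posSemidef_rescale hX (r t) z ht) fun v => ?_
      have hp : 0 < 1 + t * z v ^ 2 := by positivity
      have hr : r t v * r t v = (1 + t * z v ^ 2)⁻¹ := by
        simp only [r]
        rw [← mul_inv, Real.mul_self_sqrt hp.le]
      have : r t v * (X v v + t * (z v * z v)) * r t v
          = (1 + t * z v ^ 2)⁻¹ * (X v v + t * (z v * z v)) := by
        rw [← hr]; ring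
      change r t v * (X v v + t * (z v * z v)) * r t v ≤ 1
      rw [this, inv_mul_le_iff₀ hp]
      nlinarith [hX1 v]
    have hgd : HasDerivAt g (∑ u, ∑ v, A u v *
        (((-z u ^ 2 / 2) * X u v + z u * z v) + X u v * (-z v ^ 2 / 2))) 0 := by
      simp only [g]
      refine HasDerivAt.fun_sum fun u _ => HasDerivAt.fun_sum fun v _ => ?_
      refine HasDerivAt.const_mul _ ?_
      have h1 : HasDerivAt (fun t : ℝ => r t u) (-z u ^ 2 / 2) 0 := hasDerivAt_inv_sqrt _
      have h2 : HasDerivAt (fun t : ℝ => r t v) (-z v ^ 2 / 2) 0 := hasDerivAt_inv_sqrt _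
      have h3 : HasDerivAt (fun t : ℝ => X u v + t * (z u * z v)) (z u * z v) 0 := by
        simpa using ((hasDerivAt_id (0 : ℝ)).mul_const (z u * z v)).const_add (X u v)
      exact ((h1.fun_mul h3).fun_mul h2).congr_deriv (by simp [r])
    have hle : ∑ u, ∑ v, A u v *
        (((-z u ^ 2 / 2) * X u v + z u * z v) + X u v * (-z v ^ 2 / 2)) ≤ 0 := by
      refine le_of_tendsto hgd.tendsto_slope_zero_right ?_
      filter_upwards [self_mem_nhdsWithin] with t ht
      have ht' : (0 : ℝ) < t := ht
      have := hgle t ht'.le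
      rw [zero_add, smul_eq_mul]
      exact mul_nonpos_of_nonneg_of_nonpos (inv_pos.2 ht').le (by linarith)
    have h1 : ∑ u, ∑ v, A u v * (z u ^ 2 * X u v) = ∑ v, z v ^ 2 * D v := by
      simp only [hD, mul_sum]
      exact sum_congr rfl fun u _ => sum_congr rfl fun v _ => by ring
    have h2 : ∑ u, ∑ v, A u v * (z v ^ 2 * X u v) = ∑ v, z v ^ 2 * D v := by
      rw [sum_comm, ← h1]
      exact sum_congr rfl fun u _ => sum_congr rfl fun v _ => by rw [hAs, hXs]
    have h3 : ∑ u, ∑ v, A u v *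
        (((-z u ^ 2 / 2) * X u v + z u * z v) + X u v * (-z v ^ 2 / 2)) =
        quad A z - (∑ u, ∑ v, A u v * (z u ^ 2 * X u v)) / 2
          - (∑ u, ∑ v, A u v * (z v ^ 2 * X u v)) / 2 := by
      simp only [quad, sum_div, ← sum_sub_distrib]
      exact sum_congr rfl fun u _ => sum_congr rfl fun v _ => by ring
    rw [h3, h1, h2] at hle
    linarith
  refine ⟨X, D, hX, hX1, fun v => ?_, ?_, rfl⟩
  · have h := key (Pi.single v 1)
    simpa [quad, Pi.single_apply, hdiag] using h
  · refine Matrix.PosSemidef.of_dotProduct_mulVec_nonneg ?_ fun z => ?_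
    · ext u v
      simp only [Matrix.conjTranspose_apply, Matrix.sub_apply, star_trivial, Matrix.diagonal_apply]
      rw [hAs v u]
      by_cases h : u = v
      · subst h; rfl
      · simp [h, Ne.symm h]
    · have h1 : star z ⬝ᵥ ((Matrix.diagonal D - A) *ᵥ z) = ∑ v, z v ^ 2 * D v - quad A z := by
        rw [Matrix.sub_mulVec, dotProduct_sub]
        congr 1
        · simp only [dotProduct, Matrix.mulVec_diagonal, star_trivial]
          exact sum_congr rfl fun v _ => by ring
        · simp only [dotProduct, Matrix.mulVec, star_trivial, quad, mul_sum]
          exact sum_congr rfl fun u _ => sum_congr rfl fun v _ => by ring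
      rw [h1]
      linarith [key z]

end Duality

/-! ### The deviation matrix of a graph -/

section BlockSum

variable {V : Type*}

/-- The sum of the entries of the principal submatrix of `A` on `W`. -/
def blockSum (A : Matrix V V ℝ) (W : Finset V) : ℝ := ∑ u ∈ W, ∑ v ∈ W, A u v

variable [DecidableEq V]

lemma sum_sum_ite_ne (W : Finset V) (c : ℝ) :
    ∑ u ∈ W, ∑ v ∈ W, (if u = v then 0 else c) = c * (#W * (#W - 1)) := by
  have h : ∀ u v : V, (if u = v then 0 else c) = c - (if u = v then c else 0) := by
    intro u v; split_ifs <;> ring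
  have h2 : ∀ u ∈ W, ∑ v ∈ W, (if u = v then 0 else c) = #W * c - c := fun u hu => by
    simp [h, hu]
  rw [sum_congr rfl h2]
  simp
  ring

variable [Fintype V]

lemma blockSum_eq_sum_ite (A : Matrix V V ℝ) (W : Finset V) :
    blockSum A W = ∑ u, ∑ v, A u v * ((if u ∈ W then 1 else 0) * (if v ∈ W then 1 else 0)) := by
  simp [blockSum]

/-- With zero diagonal the form is affine in each coordinate, so coordinates can be rounded one at a
time. -/
lemma quad_update {A : Matrix V V ℝ} (hA : ∀ v, A v v = 0) (q : V → ℝ) (v : V) (t : ℝ) :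
    quad A (Function.update q v t) =
      (1 - t) * quad A (Function.update q v 0) + t * quad A (Function.update q v 1) := by
  simp only [quad, mul_sum, ← sum_add_distrib]
  refine sum_congr rfl fun a _ => sum_congr rfl fun b _ => ?_
  by_cases ha : a = v <;> by_cases hb : b = v
  · subst ha; subst hb; simp [hA]
  · subst ha; simp [hb]; ring
  · subst hb; simp [ha]; ring
  · simp [ha, hb]; ring

/-- A multilinear quadratic form on the cube `[0,1]^V` is maximised at a vertex. -/
lemma exists_quad_le_blockSum {A : Matrix V V ℝ} (hA : ∀ v, A v v = 0) {q : V → ℝ}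
    (hq : ∀ v, q v ∈ Set.Icc (0 : ℝ) 1) : ∃ U, quad A q ≤ blockSum A U := by
  have key : ∀ S : Finset V, ∃ q' : V → ℝ, (∀ v, q' v ∈ Set.Icc (0 : ℝ) 1) ∧
      (∀ v ∈ S, q' v = 0 ∨ q' v = 1) ∧ quad A q ≤ quad A q' := by
    intro S
    induction S using Finset.induction_on with
    | empty => exact ⟨q, hq, by simp, le_rfl⟩
    | insert v S _ ih =>
      obtain ⟨q', h1, h2, h3⟩ := ih
      have hmem : ∀ t ∈ ({0, 1} : Set ℝ), (∀ w, Function.update q' v t w ∈ Set.Icc (0 : ℝ) 1) ∧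
          ∀ w ∈ insert v S, Function.update q' v t w = 0 ∨ Function.update q' v t w = 1 := by
        intro t ht
        constructor
        · intro w
          by_cases hw : w = v
          · subst hw
            rcases ht with rfl | rfl <;> simp
          · simpa [hw] using h1 w
        · intro w hw
          by_cases hwv : w = v
          · subst hwv
            rcases ht with rfl | rfl <;> simp
          · simpa [hwv] using h2 w ((mem_insert.1 hw).resolve_left hwv)
      have haff := quad_update hA q' v (q' v)
      rw [Function.update_eq_self] at haff
      obtain ⟨l, r⟩ := h1 v
      rcases le_total (quad A (Function.update q' v 0)) (quad A (Function.update q' v 1))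
        with h | h
      · exact ⟨_, (hmem 1 (by simp)).1, (hmem 1 (by simp)).2, by nlinarith⟩
      · exact ⟨_, (hmem 0 (by simp)).1, (hmem 0 (by simp)).2, by nlinarith⟩
  obtain ⟨q', -, h2, h3⟩ := key univ
  refine ⟨univ.filter fun v => q' v = 1, h3.trans_eq ?_⟩
  rw [blockSum_eq_sum_ite, quad]
  refine sum_congr rfl fun a _ => sum_congr rfl fun b _ => ?_
  rcases h2 a (mem_univ _) with ha | ha <;> rcases h2 b (mem_univ _) with hb | hb <;> simp [ha, hb]

end BlockSum

section Deviation

variable {V : Type*}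

open Classical in
/-- The real adjacency matrix of a graph. -/
noncomputable def adj (G : SimpleGraph V) : Matrix V V ℝ :=
  Matrix.of fun u v => if G.Adj u v then 1 else 0

lemma adj_of_adj {G : SimpleGraph V} {u v : V} (h : G.Adj u v) : adj G u v = 1 := by simp [adj, h]

lemma adj_of_not_adj {G : SimpleGraph V} {u v : V} (h : ¬ G.Adj u v) : adj G u v = 0 := by
  simp [adj, h]

lemma adj_self (G : SimpleGraph V) (v : V) : adj G v v = 0 := by simp [adj]

lemma adj_comm (G : SimpleGraph V) (u v : V) : adj G u v = adj G v u := by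
  by_cases h : G.Adj u v
  · rw [adj_of_adj h, adj_of_adj h.symm]
  · rw [adj_of_not_adj h, adj_of_not_adj fun h' => h h'.symm]

lemma adj_eq_zero_or_one (G : SimpleGraph V) (u v : V) : adj G u v = 0 ∨ adj G u v = 1 := by
  by_cases h : G.Adj u v <;> simp [adj, h]

lemma adj_nonneg (G : SimpleGraph V) (u v : V) : 0 ≤ adj G u v := by
  rcases adj_eq_zero_or_one G u v with h | h <;> simp [h]

lemma sum_adj_eq [Fintype V] (G : SimpleGraph V) :
    ∑ u, ∑ v, adj G u v = 2 * (G.edgeSet.ncard : ℝ) := by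
  classical
  have h := G.two_mul_card_edgeFinset
  have h2 : G.edgeSet.ncard = #G.edgeFinset := by
    rw [← SimpleGraph.coe_edgeFinset, Set.ncard_coe_finset]
  rw [h2]
  have h3 : (2 : ℝ) * (#G.edgeFinset : ℝ) = ((2 * #G.edgeFinset : ℕ) : ℝ) := by push_cast; ring
  rw [h3, h]
  refine (Fintype.sum_prod_type' fun u v => adj G u v).symm.trans ?_
  simp [adj]

lemma blockSum_adj [Fintype V] (G : SimpleGraph V) (U : Finset V) :
    blockSum (adj G) U = 2 * (edgesIn G U : ℝ) := by
  have h := sum_adj_eq (G.induce (U : Set V))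
  rw [edgesIn, ← h, blockSum, ← sum_coe_sort U]
  refine sum_congr rfl fun u _ => ?_
  rw [← sum_coe_sort U]
  refine sum_congr rfl fun v _ => ?_
  by_cases h : G.Adj u v
  · rw [adj_of_adj h, adj_of_adj (show (G.induce (U : Set V)).Adj u v from h)]
  · rw [adj_of_not_adj h, adj_of_not_adj (show ¬ (G.induce (U : Set V)).Adj u v from h)]

open Classical in
/-- The matrix with entries `A_uv - p` off the diagonal and `0` on the diagonal, where `A` is the
adjacency matrix and `p` the edge density. -/
noncomputable def dev [Fintype V] (G : SimpleGraph V) : Matrix V V ℝ :=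
  Matrix.of fun u v => if u = v then 0 else adj G u v - density G

variable [Fintype V]

lemma dev_self (G : SimpleGraph V) (v : V) : dev G v v = 0 := by simp [dev]

lemma dev_of_ne (G : SimpleGraph V) {u v : V} (h : u ≠ v) : dev G u v = adj G u v - density G := by
  simp [dev, h]

lemma dev_isSymm (G : SimpleGraph V) : (dev G).IsSymm := by
  ext u v
  rw [Matrix.transpose_apply]
  by_cases h : u = v
  · rw [h]
  · rw [dev_of_ne G h, dev_of_ne G (Ne.symm h), adj_comm]

lemma density_nonneg (G : SimpleGraph V) : 0 ≤ density G := by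
  unfold density; positivity

lemma neg_density_le_dev (G : SimpleGraph V) (u v : V) : - density G ≤ dev G u v := by
  by_cases h : u = v
  · rw [h, dev_self]; linarith [density_nonneg G]
  · rw [dev_of_ne G h]; linarith [adj_nonneg G u v]

lemma blockSum_dev (G : SimpleGraph V) (W : Finset V) :
    blockSum (dev G) W = blockSum (adj G) W - density G * (#W * (#W - 1)) := by
  classical
  rw [← sum_sum_ite_ne W, blockSum, blockSum]
  simp only [← sum_sub_distrib]
  refine sum_congr rfl fun u _ => sum_congr rfl fun v _ => ?_
  by_cases h : u = v
  · subst h; simp [dev_self, adj_self]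
  · rw [dev_of_ne G h, if_neg h]

lemma blockSum_dev_eq_disc (G : SimpleGraph V) (U : Finset V) :
    blockSum (dev G) U = 2 * disc G U := by
  rw [blockSum_dev, blockSum_adj, disc, Nat.cast_choose_two]
  ring

lemma blockSum_dev_le (G : SimpleGraph V) (U : Finset V) :
    blockSum (dev G) U ≤ 2 * posDisc G := by
  rw [blockSum_dev_eq_disc]
  have : disc G U ≤ posDisc G := le_sup' (disc G) (mem_univ U)
  linarith

lemma posDisc_nonneg (G : SimpleGraph V) : 0 ≤ posDisc G := by
  have := blockSum_dev_le G ∅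
  simp [blockSum] at this
  linarith

lemma density_mul_pairs (G : SimpleGraph V) (hV : 2 ≤ Fintype.card V) :
    density G * (Fintype.card V * (Fintype.card V - 1)) = 2 * (G.edgeSet.ncard : ℝ) := by
  have h : (2 : ℝ) ≤ Fintype.card V := by exact_mod_cast hV
  rw [density, Nat.cast_choose_two]
  have h1 : (Fintype.card V : ℝ) ≠ 0 := by linarith
  have h2 : (Fintype.card V : ℝ) - 1 ≠ 0 := by linarith
  field_simp

lemma density_mul_sub_one (G : SimpleGraph V) (hV : 2 ≤ Fintype.card V) :
    density G * (Fintype.card V - 1) = avgDegree G := by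
  have h := density_mul_pairs G hV
  have h0 : (0 : ℝ) < Fintype.card V := by exact_mod_cast (by omega : 0 < Fintype.card V)
  rw [avgDegree, eq_div_iff h0.ne', ← h]
  ring

lemma sum_dev_eq_zero (G : SimpleGraph V) (hV : 2 ≤ Fintype.card V) :
    ∑ u, ∑ v, dev G u v = 0 := by
  have h := blockSum_dev G univ
  rw [blockSum, blockSum, sum_adj_eq, card_univ, density_mul_pairs G hV, sub_self] at h
  exact h

lemma quad_dev_le_of_mem_Icc (G : SimpleGraph V) {q : V → ℝ}
    (hq : ∀ v, q v ∈ Set.Icc (0 : ℝ) 1) : quad (dev G) q ≤ 2 * posDisc G := by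
  classical
  obtain ⟨U, hU⟩ := exists_quad_le_blockSum (dev_self G) hq
  exact hU.trans (blockSum_dev_le G U)

/-- Adding the values at `(1 + x)/2` and `(1 - x)/2` cancels the linear terms, and the constant term
is the zero total sum. -/
lemma quad_dev_le (G : SimpleGraph V) (hV : 2 ≤ Fintype.card V) (x : V → ℝ)
    (hx : ∀ v, |x v| ≤ 1) : quad (dev G) x ≤ 8 * posDisc G := by
  have h1 := quad_dev_le_of_mem_Icc G (q := fun v => (1 + x v) / 2) fun v => by
    have := abs_le.1 (hx v)
    constructor <;> linarith
  have h2 := quad_dev_le_of_mem_Icc G (q := fun v => (1 - x v) / 2) fun v => by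
    have := abs_le.1 (hx v)
    constructor <;> linarith
  have h3 : quad (dev G) (fun v => (1 + x v) / 2) + quad (dev G) (fun v => (1 - x v) / 2) =
      (1 / 2) * ∑ u, ∑ v, dev G u v + (1 / 2) * quad (dev G) x := by
    simp only [quad, mul_sum, ← sum_add_distrib]
    exact sum_congr rfl fun u _ => sum_congr rfl fun v _ => by ring
  rw [sum_dev_eq_zero G hV] at h3
  linarith

/-- A set containing almost all vertices cannot be much sparser than the whole graph. -/
lemma neg_le_blockSum_dev [DecidableEq V] (G : SimpleGraph V) (hV : 2 ≤ Fintype.card V)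
    (W : Finset V) :
    -- With weight `1/2` on `W` and `1` off it, the zero total sum eliminates the cross terms and
    -- leaves the block of `W` with a negative coefficient.
    -(8 * posDisc G) - 2 * density G * (#Wᶜ : ℝ) ^ 2 ≤ blockSum (dev G) W := by
  have h1 := quad_dev_le_of_mem_Icc G (q := fun v => if v ∈ W then 1 / 2 else 1) fun v => by
    split_ifs <;> norm_num
  have h2 : quad (dev G) (fun v => if v ∈ W then 1 / 2 else 1) =
      (1 / 2) * ∑ u, ∑ v, dev G u v + (1 / 2) * blockSum (dev G) Wᶜ
        - (1 / 4) * blockSum (dev G) W := by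
    rw [blockSum_eq_sum_ite, blockSum_eq_sum_ite]
    simp only [quad, mul_sum, ← sum_add_distrib, ← sum_sub_distrib, mem_compl]
    refine sum_congr rfl fun u _ => sum_congr rfl fun v _ => ?_
    by_cases hu : u ∈ W <;> by_cases hv : v ∈ W <;> simp [hu, hv] <;> ring
  have h3 : -(density G * (#Wᶜ : ℝ) ^ 2) ≤ blockSum (dev G) Wᶜ := by
    have : ∑ u ∈ Wᶜ, ∑ v ∈ Wᶜ, - density G ≤ blockSum (dev G) Wᶜ :=
      sum_le_sum fun u _ => sum_le_sum fun v _ => neg_density_le_dev G u v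
    refine le_trans (le_of_eq ?_) this
    simp only [sum_const, nsmul_eq_mul]
    ring
  rw [sum_dev_eq_zero G hV] at h2
  linarith

end Deviation

/-! ### The dense range -/

section Dense

variable {V : Type*} [Fintype V]

/-- Only the values `1 - p` and `-p` occur. The constant term is the third central moment of a
Bernoulli variable, positive for `0 < p < 1/2`. -/
lemma dev_pow_three (G : SimpleGraph V) {u v : V} (h : u ≠ v) :
    dev G u v ^ 3 = (1 - 3 * density G + 3 * density G ^ 2) * dev G u v +
      (1 - 2 * density G) * density G * (1 - density G) := by
  rw [dev_of_ne G h]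
  rcases adj_eq_zero_or_one G u v with h | h <;> rw [h] <;> ring

lemma blockSum_dev_pow_three (G : SimpleGraph V) (W : Finset V) :
    ∑ u ∈ W, ∑ v ∈ W, dev G u v ^ 3 =
      (1 - 3 * density G + 3 * density G ^ 2) * blockSum (dev G) W +
      (1 - 2 * density G) * density G * (1 - density G) * (#W * (#W - 1)) := by
  classical
  rw [← sum_sum_ite_ne W, blockSum]
  simp only [mul_sum, ← sum_add_distrib]
  refine sum_congr rfl fun u _ => sum_congr rfl fun v _ => ?_
  by_cases h : u = v
  · subst h; simp [dev_self]
  · rw [dev_pow_three G h, if_neg h]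

/-- The Hadamard square of a dual certificate is itself a test matrix. -/
theorem exists_sum_dev_pow_three_le [DecidableEq V] (G : SimpleGraph V)
    (hV : 3 ≤ Fintype.card V) {K : ℝ} (hK : 0 < K) :
    ∃ W : Finset V, K * #Wᶜ ≤ Fintype.card V ∧
      ∑ u ∈ W, ∑ v ∈ W, dev G u v ^ 3 ≤
        (48 * Real.log (Fintype.card V) * posDisc G) ^ 3 * K ^ 2 / (Fintype.card V : ℝ) ^ 2 := by
  have hquad := quad_dev_le G (by omega)
  obtain ⟨X, D, hX, hX1, hD0, hP, hsum⟩ := exists_dual (dev_isSymm G) (dev_self G)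
  have hs := matInner_le_log hquad hV hX hX1
  set n : ℝ := (Fintype.card V : ℝ) with hn
  have hn0 : 0 < n := by rw [hn]; exact_mod_cast (by omega : 0 < Fintype.card V)
  set s := 48 * Real.log n * posDisc G with hsdef
  rw [← hsum] at hs
  have hs' : ∑ v, D v ≤ s := by rw [hsdef]; linarith
  -- Markov: `∑ D ≤ s`, so `D` exceeds `R` at no more than `n / K` vertices.
  set R := K * s / n with hR
  have hs0 : 0 ≤ s := (sum_nonneg fun v _ => hD0 v).trans hs'
  have hR0 : 0 ≤ R := by positivity
  let W := univ.filter fun v => D v ≤ R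
  have hW : ∀ v, v ∈ W ↔ D v ≤ R := fun v => by simp [W]
  refine ⟨W, ?_, ?_⟩
  · rcases hs0.eq_or_lt with h0 | h0
    · have hDz : ∀ v, D v = 0 := fun v =>
        (sum_eq_zero_iff_of_nonneg fun v _ => hD0 v).1
          (le_antisymm (hs'.trans h0.ge) (sum_nonneg fun v _ => hD0 v)) v (mem_univ v)
      have : W = univ := by
        ext v; simp [hW, hDz, hR0]
      simp [this, hn0.le]
    · have h1 : #Wᶜ * R ≤ s := by
        calc (#Wᶜ : ℝ) * R = ∑ v ∈ Wᶜ, R := by simp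
          _ ≤ ∑ v ∈ Wᶜ, D v := sum_le_sum fun v hv => by
              rw [mem_compl, hW, not_le] at hv
              exact hv.le
          _ ≤ ∑ v, D v := sum_le_sum_of_subset_of_nonneg (subset_univ _) fun v _ _ => hD0 v
          _ ≤ s := hs'
      have h2 : (K * #Wᶜ) * s ≤ n * s := by
        have : #Wᶜ * R = (K * #Wᶜ) * s / n := by rw [hR]; ring
        rw [this, div_le_iff₀ hn0] at h1
        linarith
      exact le_of_mul_le_mul_right h2 h0
  · let r : V → ℝ := fun v => if v ∈ W then 1 else 0
    have hY := posSemidef_rescale (hP.hadamard hP) r r le_rfl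
    have hY1 := matInner_le_log hquad hV hY (R := R ^ 2) fun v => by
      by_cases hv : v ∈ W
      · have := (hW v).1 hv
        simp [r, hv, dev_self, ← sq]
        exact pow_le_pow_left₀ (hD0 v) this 2
      · simp [r, hv]
        positivity
    -- `D` drops out, since `dev G` vanishes on the diagonal.
    have hinner : matInner (dev G) (Matrix.of fun u v => r u *
        (((Matrix.diagonal D - dev G) ⊙ (Matrix.diagonal D - dev G)) u v + 0 * (r u * r v)) * r v)
        = ∑ u ∈ W, ∑ v ∈ W, dev G u v ^ 3 := by
      have h := blockSum_eq_sum_ite (Matrix.of fun u v => dev G u v ^ 3) W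
      simp only [blockSum, Matrix.of_apply] at h
      rw [h, matInner]
      refine sum_congr rfl fun u _ => sum_congr rfl fun v _ => ?_
      by_cases huv : u = v
      · subst huv; simp [dev_self]
      · simp [r, Matrix.diagonal_apply, huv]
        ring_nf
    rw [hinner] at hY1
    refine hY1.trans_eq ?_
    rw [hR, hsdef]
    field_simp
    ring

end Dense

/-! ### Random sine rounding -/

section Products

variable {ι : Type*}

lemma prod_sub_prod_le_sum_sub {x y : ι → ℝ} (s : Finset ι) (hy : ∀ i, 0 ≤ y i)
    (hyx : ∀ i, y i ≤ x i) (hx : ∀ i, x i ≤ 1) :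
    ∏ i ∈ s, x i - ∏ i ∈ s, y i ≤ ∑ i ∈ s, (x i - y i) := by
  classical
  induction s using Finset.induction_on with
  | empty => simp
  | insert j s hj ih =>
    rw [prod_insert hj, prod_insert hj, sum_insert hj]
    have h1 : ∏ i ∈ s, y i ≤ 1 := prod_le_one (fun i _ => hy i) fun i _ => (hyx i).trans (hx i)
    have h2 : ∏ i ∈ s, y i ≤ ∏ i ∈ s, x i := prod_le_prod (fun i _ => hy i) fun i _ => hyx i
    nlinarith [hy j, hyx j, hx j, mul_nonneg (sub_nonneg.2 (hx j)) (sub_nonneg.2 h2),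
      mul_nonneg (sub_nonneg.2 (hyx j)) (sub_nonneg.2 h1)]

/-- Only the change in factor `j` is kept; the others may only shrink the second product. -/
lemma sub_mul_prod_le_prod_sub_prod [DecidableEq ι] {x y : ι → ℝ} {s : Finset ι}
    (hy : ∀ i, 0 ≤ y i) (hyx : ∀ i, y i ≤ x i) (hx : ∀ i, x i ≤ 1) {j : ι} (hj : j ∈ s) :
    (x j - y j) * ∏ i ∈ s, x i ≤ ∏ i ∈ s, x i - ∏ i ∈ s, y i := by
  rw [← mul_prod_erase s x hj, ← mul_prod_erase s y hj]
  have h1 : 0 ≤ ∏ i ∈ s.erase j, x i := prod_nonneg fun i _ => (hy i).trans (hyx i)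
  have h2 : ∏ i ∈ s.erase j, y i ≤ ∏ i ∈ s.erase j, x i :=
    prod_le_prod (fun i _ => hy i) fun i _ => hyx i
  have h3 := mul_nonneg (mul_nonneg (sub_nonneg.2 (hyx j)) (sub_nonneg.2 (hx j))) h1
  nlinarith [mul_nonneg (hy j) (sub_nonneg.2 h2)]

lemma one_sub_sum_le_prod {x : ι → ℝ} (s : Finset ι) (hx0 : ∀ i, 0 ≤ x i) (hx : ∀ i, x i ≤ 1) :
    1 - ∑ i ∈ s, (1 - x i) ≤ ∏ i ∈ s, x i := by
  have h := prod_sub_prod_le_sum_sub (x := fun _ => 1) s hx0 hx fun _ => le_rfl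
  simp only [prod_const_one] at h
  linarith

end Products

section Sine

variable {ι : Type*} [Fintype ι] [DecidableEq ι] {a b : ι → ℝ}

lemma half_le_sin {x : ℝ} (h0 : 0 ≤ x) (h1 : x ≤ 1) : x / 2 ≤ Real.sin x := by
  have h := Real.mul_le_sin h0 (by linarith [Real.pi_gt_three])
  refine le_trans ?_ h
  have : 1 / 2 ≤ 2 / Real.pi := by
    rw [div_le_div_iff₀ (by norm_num) Real.pi_pos]
    linarith [Real.pi_lt_four]
  nlinarith

lemma cos_add_le_cos_sub {x y : ℝ} (hx0 : 0 ≤ x) (hx : x ≤ 1 / 2) (hy0 : 0 ≤ y) (hy : y ≤ 1 / 2) :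
    0 ≤ Real.cos (x + y) ∧ Real.cos (x + y) ≤ Real.cos (x - y) ∧
      Real.cos (x - y) - Real.cos (x + y) ≤ 2 * (x * y) ∧
      x * y / 2 ≤ Real.cos (x - y) - Real.cos (x + y) := by
  have hd : Real.cos (x - y) - Real.cos (x + y) = 2 * (Real.sin x * Real.sin y) := by
    rw [Real.cos_sub, Real.cos_add]; ring
  have hx1 := half_le_sin hx0 (by linarith)
  have hy1 := half_le_sin hy0 (by linarith)
  have hlow : x / 2 * (y / 2) ≤ Real.sin x * Real.sin y :=
    mul_le_mul hx1 hy1 (by linarith) (by linarith)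
  have hup : Real.sin x * Real.sin y ≤ x * y :=
    mul_le_mul (Real.sin_le hx0) (Real.sin_le hy0) (by linarith) hx0
  have hxy : 0 ≤ x * y := mul_nonneg hx0 hy0
  refine ⟨Real.cos_nonneg_of_mem_Icc ⟨?_, ?_⟩, ?_, ?_, ?_⟩ <;>
    linarith [Real.pi_gt_three]

lemma expect_sin_mul_sin_le (ha : ∀ i, a i ∈ Set.Icc (0 : ℝ) (1 / 2))
    (hb : ∀ i, b i ∈ Set.Icc (0 : ℝ) (1 / 2)) :
    𝔼 ξ, Real.sin (signSum a ξ) * Real.sin (signSum b ξ) ≤ ∑ i, a i * b i := by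
  have h := fun i => cos_add_le_cos_sub (ha i).1 (ha i).2 (hb i).1 (hb i).2
  have h1 := prod_sub_prod_le_sum_sub univ (fun i => (h i).1) (fun i => (h i).2.1)
    fun i => Real.cos_le_one _
  have h2 := sum_le_sum (s := univ) fun i _ => (h i).2.2.1
  rw [← mul_sum] at h2
  rw [expect_sin_mul_sin]
  linarith

/-- One shared coordinate already forces correlation; the norm condition keeps `∏ cos (a i - b i)`
at least `1/2`. -/
lemma le_expect_sin_mul_sin (ha : ∀ i, a i ∈ Set.Icc (0 : ℝ) (1 / 2))
    (hb : ∀ i, b i ∈ Set.Icc (0 : ℝ) (1 / 2)) (hsum : ∑ i, a i ^ 2 + ∑ i, b i ^ 2 ≤ 1) (j : ι) :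
    a j * b j / 8 ≤ 𝔼 ξ, Real.sin (signSum a ξ) * Real.sin (signSum b ξ) := by
  have h := fun i => cos_add_le_cos_sub (ha i).1 (ha i).2 (hb i).1 (hb i).2
  have h1 := sub_mul_prod_le_prod_sub_prod (fun i => (h i).1) (fun i => (h i).2.1)
    (fun i => Real.cos_le_one _) (mem_univ j)
  have h2 := one_sub_sum_le_prod univ (fun i => (h i).1.trans (h i).2.1)
    fun i => Real.cos_le_one _
  have h3 : ∑ i, (1 - Real.cos (a i - b i)) ≤ (∑ i, a i ^ 2 + ∑ i, b i ^ 2) / 2 := by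
    rw [← sum_add_distrib, sum_div]
    refine sum_le_sum fun i _ => ?_
    have := Real.one_sub_sq_div_two_le_cos (x := a i - b i)
    nlinarith [mul_nonneg (ha i).1 (hb i).1]
  have h4 : 1 / 2 ≤ ∏ i, Real.cos (a i - b i) := by linarith
  have h5 : 0 ≤ a j * b j := mul_nonneg (ha j).1 (hb j).1
  rw [expect_sin_mul_sin]
  nlinarith [(h j).2.2.2]

end Sine

/-! ### The sparse range -/

section Sparse

variable {V : Type*}

/-- Paths of length two are counted by their middle vertex. -/
lemma sum_sum_codegree_le [Fintype V] (G : SimpleGraph V) (W : Finset V) {Δ : ℝ}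
    (hW : ∀ w ∈ W, ∑ v, adj G w v ≤ Δ) :
    ∑ u ∈ W, ∑ v ∈ W, ∑ w ∈ W, adj G u w * adj G v w ≤ Fintype.card V * Δ ^ 2 := by
  have h1 : ∑ u ∈ W, ∑ v ∈ W, ∑ w ∈ W, adj G u w * adj G v w =
      ∑ w ∈ W, (∑ u ∈ W, adj G w u) ^ 2 := by
    rw [sum_congr rfl fun u _ => sum_comm, sum_comm]
    refine sum_congr rfl fun w _ => ?_
    rw [sq, sum_mul_sum]
    exact sum_congr rfl fun u _ => sum_congr rfl fun v _ => by
      rw [adj_comm G u w, adj_comm G v w]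
  have h2 : ∀ w ∈ W, (∑ u ∈ W, adj G w u) ^ 2 ≤ Δ ^ 2 := fun w hw => by
    refine pow_le_pow_left₀ (sum_nonneg fun u _ => adj_nonneg G w u) ?_ 2
    exact (sum_le_sum_of_subset_of_nonneg (subset_univ _) fun u _ _ => adj_nonneg G w u).trans
      (hW w hw)
  rw [h1]
  refine (sum_le_sum h2).trans ?_
  rw [sum_const, nsmul_eq_mul]
  have : (#W : ℝ) ≤ Fintype.card V := by exact_mod_cast card_le_univ W
  gcongr

variable [DecidableEq V]

/-- The coefficients of the random linear form attached to a vertex `v`: weight `1/2` on `v` and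
weight `β` on each neighbour of `v` in `W`. -/
noncomputable def nbrWeight (G : SimpleGraph V) (W : Finset V) (β : ℝ) (v w : V) : ℝ :=
  if w = v then 1 / 2 else if w ∈ W then β * adj G v w else 0

lemma nbrWeight_mem_Icc (G : SimpleGraph V) (W : Finset V) {β : ℝ} (h0 : 0 ≤ β) (h1 : β ≤ 1 / 2)
    (v w : V) : nbrWeight G W β v w ∈ Set.Icc (0 : ℝ) (1 / 2) := by
  unfold nbrWeight
  rcases adj_eq_zero_or_one G v w with h | h <;> rw [h] <;> split_ifs <;>
    constructor <;> linarith

variable [Fintype V]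

lemma sum_nbrWeight_sq_le (G : SimpleGraph V) (W : Finset V) (β : ℝ) (v : V) :
    ∑ w, nbrWeight G W β v w ^ 2 ≤ 1 / 4 + β ^ 2 * ∑ w, adj G v w := by
  have h : ∀ w, nbrWeight G W β v w ^ 2 ≤ (if w = v then 1 / 4 else 0) + β ^ 2 * adj G v w := by
    intro w
    unfold nbrWeight
    rcases adj_eq_zero_or_one G v w with h | h <;> rw [h] <;> split_ifs <;> nlinarith [sq_nonneg β]
  refine (sum_le_sum fun w _ => h w).trans_eq ?_
  rw [sum_add_distrib, mul_sum]
  simp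

lemma sum_nbrWeight_mul_le (G : SimpleGraph V) (W : Finset V) {β : ℝ} (h0 : 0 ≤ β) {u v : V}
    (huv : u ≠ v) :
    ∑ w, nbrWeight G W β u w * nbrWeight G W β v w ≤
      β * adj G u v + β ^ 2 * ∑ w ∈ W, adj G u w * adj G v w := by
  have h : ∀ w, nbrWeight G W β u w * nbrWeight G W β v w ≤
      (if w = u then β * adj G u v / 2 else 0) + (if w = v then β * adj G u v / 2 else 0) +
        (if w ∈ W then β ^ 2 * (adj G u w * adj G v w) else 0) := by
    intro w
    have hn := mul_nonneg (adj_nonneg G u w) (adj_nonneg G v w)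
    have hb := mul_nonneg (sq_nonneg β) hn
    have hc := mul_nonneg h0 (adj_nonneg G u v)
    unfold nbrWeight
    by_cases hu : w = u
    · subst hu
      simp only [huv, if_true, if_false, adj_comm G v w, adj_self, zero_mul, mul_zero]
      split_ifs <;> linarith
    · by_cases hv : w = v
      · subst hv
        simp only [hu, if_true, if_false]
        split_ifs <;> linarith
      · simp only [hu, hv, if_false]
        split_ifs <;> nlinarith
  refine (sum_le_sum fun w _ => h w).trans_eq ?_
  rw [sum_add_distrib, sum_add_distrib, mul_sum]
  simp

/-- A lower bound for the positive discrepancy in terms of a set of vertices of bounded degree. -/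
theorem le_posDisc_of_degree_le (G : SimpleGraph V) (hV : 2 ≤ Fintype.card V) (W : Finset V)
    {Δ β : ℝ} (hW : ∀ w ∈ W, ∑ v, adj G w v ≤ Δ) (h0 : 0 ≤ β) (h1 : β ≤ 1 / 2)
    (hβ : 4 * Δ * β ^ 2 ≤ 1) :
    (1 / 16 - density G) * β * blockSum (adj G) W
      - density G * β ^ 2 * (Fintype.card V * Δ ^ 2) ≤ 8 * posDisc G := by
  let c := nbrWeight G W β
  have hc : ∀ v w, c v w ∈ Set.Icc (0 : ℝ) (1 / 2) := nbrWeight_mem_Icc G W h0 h1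
  let x : (V → Bool) → V → ℝ := fun ξ v => if v ∈ W then Real.sin (signSum (c v) ξ) else 0
  have hx : ∀ ξ v, |x ξ v| ≤ 1 := fun ξ v => by
    simp only [x]
    split_ifs
    · exact Real.abs_sin_le_one _
    · simp
  have hE : 𝔼 ξ, quad (dev G) (x ξ) ≤ 8 * posDisc G :=
    (expect_le_expect (s := univ) fun ξ _ => quad_dev_le G hV (x ξ) (hx ξ)).trans_eq (by simp)
  refine le_trans ?_ hE
  have hq : ∀ ξ, quad (dev G) (x ξ) = ∑ u ∈ W, ∑ v ∈ W,
      dev G u v * (Real.sin (signSum (c u) ξ) * Real.sin (signSum (c v) ξ)) := by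
    intro ξ
    have h := blockSum_eq_sum_ite (Matrix.of fun u v =>
      dev G u v * (Real.sin (signSum (c u) ξ) * Real.sin (signSum (c v) ξ))) W
    simp only [blockSum, Matrix.of_apply] at h
    rw [h, quad]
    refine sum_congr rfl fun u _ => sum_congr rfl fun v _ => ?_
    by_cases hu : u ∈ W <;> by_cases hv : v ∈ W <;> simp [x, hu, hv]
  simp only [hq, expect_sum_comm, ← mul_expect]
  -- In `A_uv - p`, the first part uses the lower covariance bound on edges, the second the upper
  -- bound on all pairs.
  have hterm : ∀ u ∈ W, ∀ v ∈ W, (1 / 16 - density G) * β * adj G u v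
      - density G * β ^ 2 * ∑ w ∈ W, adj G u w * adj G v w ≤
      dev G u v * 𝔼 ξ, Real.sin (signSum (c u) ξ) * Real.sin (signSum (c v) ξ) := by
    intro u hu v hv
    have hp := density_nonneg G
    by_cases huv : u = v
    · subst huv
      rw [adj_self, dev_self]
      have : 0 ≤ ∑ w ∈ W, adj G u w * adj G u w := sum_nonneg fun w _ => mul_self_nonneg _
      have : 0 ≤ density G * β ^ 2 * ∑ w ∈ W, adj G u w * adj G u w := by positivity
      linarith
    · have hup := (expect_sin_mul_sin_le (hc u) (hc v)).trans (sum_nbrWeight_mul_le G W h0 huv)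
      have hpup := mul_le_mul_of_nonneg_left hup hp
      rw [dev_of_ne G huv]
      by_cases ha : G.Adj u v
      · have hs : ∑ i, c u i ^ 2 + ∑ i, c v i ^ 2 ≤ 1 := by
          have hu' := sum_nbrWeight_sq_le G W β u
          have hv' := sum_nbrWeight_sq_le G W β v
          have hu2 := mul_le_mul_of_nonneg_left (hW u hu) (sq_nonneg β)
          have hv2 := mul_le_mul_of_nonneg_left (hW v hv) (sq_nonneg β)
          simp only [c]
          linarith
        have hlow := le_expect_sin_mul_sin (hc u) (hc v) hs u
        have hcu : c u u = 1 / 2 := by simp [c, nbrWeight]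
        have hcv : c v u = β := by simp [c, nbrWeight, huv, hu, adj_of_adj ha.symm]
        rw [hcu, hcv] at hlow
        rw [adj_of_adj ha] at hpup ⊢
        linarith
      · rw [adj_of_not_adj ha] at hpup ⊢
        linarith
  refine le_trans ?_ (sum_le_sum fun u hu => sum_le_sum fun v hv => hterm u hu v hv)
  simp only [sum_sub_distrib, ← mul_sum]
  have hcod := mul_le_mul_of_nonneg_left (sum_sum_codegree_le G W hW)
    (mul_nonneg (density_nonneg G) (sq_nonneg β))
  rw [blockSum]
  linarith

lemma card_compl_degree_le (G : SimpleGraph V) {Δ : ℝ} (W : Finset V)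
    (hW : ∀ w, w ∉ W → Δ ≤ ∑ v, adj G w v) :
    #Wᶜ * Δ ≤ Fintype.card V * avgDegree G := by
  have hle : #Wᶜ * Δ ≤ 2 * (G.edgeSet.ncard : ℝ) := by
    rw [← sum_adj_eq]
    calc (#Wᶜ : ℝ) * Δ = ∑ v ∈ Wᶜ, Δ := by simp
      _ ≤ ∑ w ∈ Wᶜ, ∑ v, adj G w v := sum_le_sum fun w hw => hW w (mem_compl.1 hw)
      _ ≤ ∑ w, ∑ v, adj G w v := sum_le_sum_of_subset_of_nonneg (subset_univ _)
          fun w _ _ => sum_nonneg fun v _ => adj_nonneg G w v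
  rcases (Nat.cast_nonneg (α := ℝ) (Fintype.card V)).eq_or_lt with h | h
  · have hemp : IsEmpty V := Fintype.card_eq_zero_iff.1 (by exact_mod_cast h.symm)
    simp [Subsingleton.elim Wᶜ ∅]
  · rw [avgDegree, mul_div_cancel₀ _ h.ne']
    exact hle

end Sparse

/-! ### Lower bounds for the positive discrepancy -/

section Bounds

variable {V : Type*} [Fintype V]

lemma avgDegree_le_density_mul (G : SimpleGraph V) (hV : 2 ≤ Fintype.card V) :
    avgDegree G ≤ density G * Fintype.card V := by
  have := density_mul_sub_one G hV
  have := density_nonneg G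
  linarith

lemma density_mul_le_two_mul (G : SimpleGraph V) (hV : 2 ≤ Fintype.card V) :
    density G * Fintype.card V ≤ 2 * avgDegree G := by
  have h := density_mul_sub_one G hV
  have hn : (2 : ℝ) ≤ Fintype.card V := by exact_mod_cast hV
  nlinarith [density_nonneg G]

lemma half_sq_le_card_mul [DecidableEq V] (W : Finset V) (hV : 12 ≤ Fintype.card V)
    (hW : 4 * (#Wᶜ : ℝ) ≤ Fintype.card V) :
    (Fintype.card V : ℝ) ^ 2 / 2 ≤ #W * (#W - 1) := by
  have hn : (12 : ℝ) ≤ Fintype.card V := by exact_mod_cast hV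
  have h : (#W : ℝ) + #Wᶜ = Fintype.card V := by exact_mod_cast card_add_card_compl W
  have h1 : 3 / 4 * (Fintype.card V : ℝ) ≤ #W := by linarith
  calc (Fintype.card V : ℝ) ^ 2 / 2
      ≤ (3 / 4 * (Fintype.card V : ℝ)) * (3 / 4 * (Fintype.card V : ℝ) - 1) := by nlinarith
    _ ≤ #W * (#W - 1) := mul_le_mul h1 (by linarith) (by linarith) (by linarith)

/-- The lower bound given by random sine rounding with neighbour weight `β`. -/
theorem mul_le_posDisc_of_sparse (G : SimpleGraph V) (hV : 12 ≤ Fintype.card V) {β : ℝ}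
    (hd1 : 1 ≤ avgDegree G) (hd : 32 * avgDegree G ≤ Fintype.card V - 1)
    (h0 : 0 ≤ β) (h1 : β ≤ 1 / 2) (h2 : 64 * avgDegree G * β ^ 2 ≤ 1)
    (h3 : 8192 * β * avgDegree G ^ 2 ≤ Fintype.card V) :
    β * avgDegree G * Fintype.card V / 2048 ≤ posDisc G := by
  classical
  have hp0 := density_nonneg G
  have hpn := avgDegree_le_density_mul G (by omega)
  have hpn2 := density_mul_le_two_mul G (by omega)
  have hpd := density_mul_sub_one G (by omega)
  have hM := posDisc_nonneg G
  -- By Markov at most `n/4` vertices are lost.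
  let W := univ.filter fun w => ∑ v, adj G w v ≤ 4 * avgDegree G
  have hWc := card_compl_degree_le G (Δ := 4 * avgDegree G) W fun w hw => by
    simp only [W, mem_filter, mem_univ, true_and, not_le] at hw
    exact hw.le
  have hWle : ∀ w ∈ W, ∑ v, adj G w v ≤ 4 * avgDegree G := fun w hw => (mem_filter.1 hw).2
  have hsp := le_posDisc_of_degree_le G (by omega) W hWle h0 h1 (by nlinarith)
  have hB := neg_le_blockSum_dev G (by omega) W
  rw [blockSum_dev] at hB
  have hn : (12 : ℝ) ≤ Fintype.card V := by exact_mod_cast hV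
  have hWc' : 4 * (#Wᶜ : ℝ) ≤ Fintype.card V := by
    refine le_of_mul_le_mul_right ?_ (by linarith : 0 < avgDegree G)
    linarith
  have hWW := half_sq_le_card_mul W hV hWc'
  generalize (Fintype.card V : ℝ) = n at *
  generalize avgDegree G = d at *
  generalize density G = p at *
  generalize posDisc G = M at *
  generalize blockSum (adj G) W = S at *
  have hp32 : p ≤ 1 / 32 := by
    refine le_of_mul_le_mul_right ?_ (by linarith : 0 < n - 1)
    linarith
  have hdn : 0 ≤ d * n := by positivity
  have hβdn : β * d * n ≤ d * n / 2 := by nlinarith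
  -- A large `M` gives the conclusion at once, as `β ≤ 1/2`; otherwise `W` retains a positive
  -- proportion of the edges.
  rcases le_or_gt M (d * n / 64) with hMs | hMs
  · have hc2 : (#Wᶜ : ℝ) ^ 2 ≤ n ^ 2 / 16 := by
      have : (0 : ℝ) ≤ #Wᶜ := Nat.cast_nonneg _
      nlinarith
    have e1 := mul_le_mul_of_nonneg_left hc2 hp0
    have e2 := mul_le_mul_of_nonneg_left hWW hp0
    have e3 : d * n ≤ p * n ^ 2 := by nlinarith
    have hS : d * n / 4 ≤ S := by linarith
    have e4 : 1 / 32 * β * (d * n / 4) ≤ (1 / 16 - p) * β * S := by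
      have : 1 / 32 * β ≤ (1 / 16 - p) * β := by nlinarith
      exact mul_le_mul this hS (by positivity) (le_trans (by positivity) this)
    have e5 : p * β ^ 2 * (n * (4 * d) ^ 2) ≤ 32 * β ^ 2 * d ^ 3 := by
      have := mul_le_mul_of_nonneg_right hpn2 (by positivity : 0 ≤ 16 * β ^ 2 * d ^ 2)
      linarith
    have e6 : 32 * β ^ 2 * d ^ 3 ≤ β * d * n / 256 := by
      have := mul_le_mul_of_nonneg_right h3 (by positivity : 0 ≤ β * d / 256)
      linarith
    linarith
  · linarith

/-- The lower bound given by semidefinite duality and the Schur product theorem. -/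
theorem lt_posDisc_of_dense (G : SimpleGraph V) (hV : 12 ≤ Fintype.card V) {ε : ℝ}
    (hε : 0 < ε) (hε2 : ε < 1 / 2) (hεn : 1 ≤ ε * Fintype.card V) (hd1 : 1 ≤ avgDegree G)
    (hd : avgDegree G ≤ (1 / 2 - ε) * Fintype.card V) {y : ℝ} (hy : 1 ≤ y)
    (hy3 : y ^ 3 ≤ avgDegree G) :
    ε / 1000 * y * Fintype.card V / Real.log (Fintype.card V) < posDisc G := by
  classical
  by_contra! hcon
  have hp0 := density_nonneg G
  have hpn := avgDegree_le_density_mul G (by omega)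
  have hpd := density_mul_sub_one G (by omega)
  have hM := posDisc_nonneg G
  -- `K = 8/ε` leaves out at most `εn/8` vertices, so the loss `p |Wᶜ|²` stays well below the main
  -- term of order `ε p n²`.
  obtain ⟨W, hWc, hW3⟩ := exists_sum_dev_pow_three_le G (by omega) (by positivity : 0 < 8 / ε)
  have hB := neg_le_blockSum_dev G (by omega) W
  have hn : (12 : ℝ) ≤ Fintype.card V := by exact_mod_cast hV
  have hWc1 : (#Wᶜ : ℝ) ≤ ε * Fintype.card V / 8 := by
    rw [div_mul_eq_mul_div, div_le_iff₀ hε] at hWc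
    linarith
  have hWW := half_sq_le_card_mul W hV (by nlinarith)
  rw [blockSum_dev_pow_three] at hW3
  have hL : 1 ≤ Real.log (Fintype.card V) := by
    rw [Real.le_log_iff_exp_le (by linarith)]
    linarith [Real.exp_one_lt_d9]
  generalize (Fintype.card V : ℝ) = n at *
  generalize avgDegree G = d at *
  generalize density G = p at *
  generalize posDisc G = M at *
  generalize blockSum (dev G) W = B at *
  generalize Real.log n = L at *
  rw [le_div_iff₀ (by linarith)] at hcon
  have hn0 : 0 < n := by linarith
  have hdn : 0 < d * n := by positivity
  have hyd : y ≤ d := by nlinarith [sq_nonneg (y - 1)]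
  have hML : M ≤ ε / 1000 * d * n := by
    calc M ≤ M * L := le_mul_of_one_le_right hM hL
      _ ≤ ε / 1000 * y * n := hcon
      _ ≤ ε / 1000 * d * n := by gcongr
  -- The bound is `ε`, not `2ε`: the rest absorbs the passage from `n` to `n - 1`, using `1 ≤ ε n`.
  have hp1 : ε ≤ 1 - 2 * p := by
    refine le_of_mul_le_mul_right ?_ (by linarith : 0 < n - 1)
    linarith
  have hup : (48 * L * M) ^ 3 * (8 / ε) ^ 2 / n ^ 2 ≤ ε * (d * n) / 128 := by
    calc (48 * L * M) ^ 3 * (8 / ε) ^ 2 / n ^ 2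
        ≤ (48 * (ε / 1000 * y * n)) ^ 3 * (8 / ε) ^ 2 / n ^ 2 := by
          gcongr ?_ ^ 3 * _ / _
          linarith
      _ = 48 ^ 3 * 64 / 1000 ^ 3 * ε * n * y ^ 3 := by field_simp; ring
      _ ≤ 48 ^ 3 * 64 / 1000 ^ 3 * ε * n * d := by gcongr
      _ ≤ ε * (d * n) / 128 := by linarith [mul_pos hε hdn]
  have hc2 : (#Wᶜ : ℝ) ^ 2 ≤ ε * n ^ 2 / 128 := by
    calc (#Wᶜ : ℝ) ^ 2 ≤ (ε * n / 8) ^ 2 := by gcongr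
      _ = ε * (ε * n ^ 2) / 64 := by ring
      _ ≤ 1 / 2 * (ε * n ^ 2) / 64 := by gcongr
      _ = _ := by ring
  have e1 := mul_le_mul_of_nonneg_left hc2 hp0
  have hdpn : d * n ≤ p * n ^ 2 := by
    rw [sq, ← mul_assoc]
    exact mul_le_mul_of_nonneg_right hpn hn0.le
  have hBlow : -(8 * M) - ε * (p * n ^ 2) / 64 ≤ B := by linarith
  have ha0 : 0 ≤ 1 - 3 * p + 3 * p ^ 2 := by linarith [sq_nonneg (2 * p - 1)]
  have ha1 : 1 - 3 * p + 3 * p ^ 2 ≤ 1 := by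
    linarith [mul_nonneg hp0 (by linarith : 0 ≤ 1 - p)]
  have hX0 : 0 ≤ 8 * M + ε * (p * n ^ 2) / 64 := by positivity
  have haB : -(8 * M) - ε * (p * n ^ 2) / 64 ≤ (1 - 3 * p + 3 * p ^ 2) * B := by
    have e := mul_le_mul_of_nonneg_left hBlow ha0
    have e' := mul_le_mul_of_nonneg_right ha1 hX0
    linarith
  have hb : ε * p / 2 ≤ (1 - 2 * p) * p * (1 - p) := by
    have h1 : ε * p ≤ (1 - 2 * p) * p := mul_le_mul_of_nonneg_right hp1 hp0
    rw [div_eq_mul_one_div]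
    exact mul_le_mul h1 (by linarith) (by norm_num) (le_trans (by positivity) h1)
  have hbW : ε * p / 2 * (n ^ 2 / 2) ≤ (1 - 2 * p) * p * (1 - p) * (#W * (#W - 1)) :=
    mul_le_mul hb hWW (by positivity) (le_trans (by positivity) hb)
  have e7 := mul_le_mul_of_nonneg_left hdpn hε.le
  have e8 := mul_pos hε hdn
  linarith

end Bounds

end GraphDisc

/-! ### Choice of parameters in the three ranges -/

theorem theorem1p2 :
    ∃ c : ℝ, 0 < c ∧ ∀ ε : ℝ, 0 < ε → ε < 1 / 2 → ∃ c₁ : ℝ, 0 < c₁ ∧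
      ∃ n₀ : ℕ, ∀ n : ℕ, n₀ ≤ n →
        ∀ (V : Type u) [Fintype V], Fintype.card V = n →
        ∀ (G : SimpleGraph V) (d : ℝ), d = GraphDisc.avgDegree G → 1 ≤ d →
          (d ≤ (n : ℝ) ^ (2 / 3 : ℝ) →
            GraphDisc.posDisc G > c * d ^ (1 / 2 : ℝ) * (n : ℝ)) ∧
          ((n : ℝ) ^ (2 / 3 : ℝ) ≤ d → d ≤ (n : ℝ) ^ (4 / 5 : ℝ) →
            GraphDisc.posDisc G > c * (n : ℝ) ^ 2 / d) ∧
          ((n : ℝ) ^ (4 / 5 : ℝ) ≤ d → d ≤ (1 / 2 - ε) * (n : ℝ) →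
            GraphDisc.posDisc G > c₁ * d ^ (1 / 4 : ℝ) * (n : ℝ) / Real.log (n : ℝ)) := by
  refine ⟨1 / 2 ^ 25, by positivity, fun ε hε hε2 => ⟨ε / 1000, by positivity,
    max (2 ^ 30) ⌈1 / ε⌉₊, ?_⟩⟩
  intro n hn V _ hV G d hd hd1
  subst hV hd
  have hn1 : 2 ^ 30 ≤ Fintype.card V := (le_max_left _ _).trans hn
  have hn2 : 1 / ε ≤ Fintype.card V := (Nat.le_ceil _).trans
    (by exact_mod_cast (le_max_right _ _).trans hn)
  have hV12 : 12 ≤ Fintype.card V := le_trans (by norm_num) hn1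
  have hnR : (2 : ℝ) ^ 30 ≤ Fintype.card V := by exact_mod_cast hn1
  have hsp := fun β => GraphDisc.mul_le_posDisc_of_sparse G hV12 (β := β) hd1
  have hde := fun y => GraphDisc.lt_posDisc_of_dense G hV12 hε hε2
    (by rw [div_le_iff₀ hε] at hn2; linarith) hd1 (y := y)
  generalize (Fintype.card V : ℝ) = n at *
  generalize GraphDisc.avgDegree G = d at *
  have hn0 : 0 < n := lt_of_lt_of_le (by positivity) hnR
  have hd0 : 0 < d := by linarith
  -- The threshold `2^30` is what makes `n^(1/5) ≥ 64`.
  have hsmall : d ≤ n ^ (4 / 5 : ℝ) → 32 * d ≤ n - 1 := by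
    intro h
    have h5 : (64 : ℝ) ≤ n ^ (1 / 5 : ℝ) := by
      calc (64 : ℝ) = ((2 : ℝ) ^ 30) ^ (1 / 5 : ℝ) := by
            rw [← Real.rpow_natCast, ← Real.rpow_mul (by norm_num)]
            norm_num
        _ ≤ n ^ (1 / 5 : ℝ) := by gcongr
    have hmul : n ^ (4 / 5 : ℝ) * n ^ (1 / 5 : ℝ) = n := by
      rw [← Real.rpow_add hn0]; norm_num
    have : (0 : ℝ) < n ^ (4 / 5 : ℝ) := by positivity
    nlinarith
  have hcube : (n ^ (2 / 3 : ℝ)) ^ 3 = n ^ 2 := by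
    rw [← Real.rpow_natCast, ← Real.rpow_mul hn0.le, ← Real.rpow_natCast]
    norm_num
  refine ⟨fun h => ?_, fun h h' => ?_, fun _ h' => ?_⟩
  · rw [← Real.sqrt_eq_rpow]
    have hs : √d ^ 2 = d := Real.sq_sqrt hd0.le
    have hs1 : 1 ≤ √d := Real.one_le_sqrt.2 hd1
    have hd3 : √d ^ 3 ≤ n := by
      have h3 : d ^ 3 ≤ n ^ 2 := by rw [← hcube]; gcongr
      refine le_of_sq_le_sq ?_ hn0.le
      calc (√d ^ 3) ^ 2 = (√d ^ 2) ^ 3 := by ring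
        _ ≤ n ^ 2 := by rw [hs]; exact h3
    have h45 : n ^ (2 / 3 : ℝ) ≤ n ^ (4 / 5 : ℝ) :=
      Real.rpow_le_rpow_of_exponent_le (le_trans (by norm_num) hnR) (by norm_num)
    -- This `β` turns the codegree condition into `d^(3/2) ≤ n`, which is the boundary of the range.
    have hmain := hsp (1 / (8192 * √d)) (hsmall (h.trans h45)) (by positivity)
    generalize √d = s at *
    subst hs
    have hs0 : 0 < s := by linarith
    have hmain := hmain
      (by rw [div_le_div_iff₀ (by positivity) (by norm_num)]; linarith)
      (by field_simp; norm_num)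
      (by
        refine le_trans (le_of_eq ?_) hd3
        field_simp)
    refine lt_of_lt_of_le ?_ hmain
    have he : 1 / (8192 * s) * s ^ 2 * n / 2048 = s * n / 2 ^ 24 := by field_simp; norm_num
    rw [he]
    have : 0 < s * n := by positivity
    norm_num
    linarith
  · have h3 : n ^ 2 ≤ d ^ 3 := by rw [← hcube]; gcongr
    have hnd : n ≤ d ^ 2 := by
      refine le_of_sq_le_sq ?_ (by positivity)
      nlinarith [pow_pos hd0 3]
    -- The largest `β` allowed by the codegree condition, which holds with equality.
    have hmain := hsp (n / (8192 * d ^ 2)) (hsmall h') (by positivity)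
      (by rw [div_le_div_iff₀ (by positivity) (by norm_num)]; nlinarith)
      (by
        have : 64 * d * (n / (8192 * d ^ 2)) ^ 2 = n ^ 2 / (2 ^ 20 * d ^ 3) := by
          field_simp; norm_num
        rw [this, div_le_one (by positivity)]
        linarith [pow_pos hd0 3])
      (le_of_eq (by field_simp))
    refine lt_of_lt_of_le ?_ hmain
    have he : n / (8192 * d ^ 2) * d * n / 2048 = 2 * (1 / 2 ^ 25 * n ^ 2 / d) := by
      field_simp; norm_num
    rw [he]
    have : 0 < 1 / 2 ^ 25 * n ^ 2 / d := by positivity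
    linarith
  -- Here `y = d^(1/4)`, although any `y ≥ 1` up to `d^(1/3)` is allowed.
  · refine hde _ h' (Real.one_le_rpow hd1 (by norm_num)) ?_
    rw [← Real.rpow_natCast, ← Real.rpow_mul hd0.le]
    calc d ^ ((1 / 4 : ℝ) * (3 : ℕ)) ≤ d ^ (1 : ℝ) :=
          Real.rpow_le_rpow_of_exponent_le hd1 (by norm_num)
      _ = d := Real.rpow_one d
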